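/- Let $B\ge 1$ be an integer, let $M>0$, and let $\mathcal X\subset\mathbb C$ be a constellation of cardinality $2^M$ with $2^{-M}\sum_{x\in\mathcal X}|x|^2=1$. Consider the block-fading channel $$\mathbf y_b=\sqrt{\mathrm{SNR}}\,h_b\,\mathbf x_b+\mathbf z_b,\qquad b=1,\dots,B,$$ with $\mathbf x_b\in\mathcal X^L$ and $\mathbf y_b\in\mathbb C^L$. The noise vectors $\mathbf z_b$ have i.i.d. circularly symmetric complex Gaussian $\mathcal N_{\mathbb C}(0,1)$ entries. The fading coefficients $h_1,\dots,h_B\in\mathbb C$ are i.i.d., independent of the noise, and known to the receiver. Their power gains $\gamma_b=|h_b|^2$ have the Nakagami-$m$ power density $\frac{m^m\xi^{m-1}}{\Gamma(m)}e^{-m\xi}$, $\xi\ge 0$, for some $m>0$. Let $R\ge 0$, and let the block length $L=L(\mathrm{SNR})\in\mathbb N$ satisfy $\lim_{\mathrm{SNR}\to\infty}L(\mathrm{SNR})/\log \mathrm{SNR}=\lambda\in\mathbb R$. Consider the random code with $\lceil 2^{BLR}\rceil$ codewords, all of whose symbols are drawn independently and uniformly from $\mathcal X$, equiprobable messages, and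 maximum-likelihood decoding with arbitrary tie-breaking. Let $\overline{P_e}(\mathrm{SNR})$ be its word error probability, averaged over codes, messages, fading and noise, and let $$d^{(r)}(R)=\liminf_{\mathrm{SNR}\to\infty}\frac{-\log \overline{P_e}(\mathrm{SNR})}{\log \mathrm{SNR}}\in[-\infty,\infty]\qquad(-\log 0=\infty)$$ be the SNR exponent. Put $d_B(R)=1+\left\lfloor B\left(1-\frac RM\right)\right\rfloor$. Then $$d^{(r)}(R)\ \ge\ \begin{cases}\lambda BM\log (2)\left(1-\frac RM\right), & \lambda<\frac{m}{M\log 2},\\[4pt] m\,(d_B(R)-1)+\min\left\{m,\ \lambda M\log (2)\left(B\left(1-\frac RM\right)-d_B(R)+1\right)\right\}, & \lambda\ge\frac{m}{M\log 2},\end{cases}$$ where $\log$ is the natural logarithm. -/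

import Mathlib

open MeasureTheory ProbabilityTheory Filter Topology
open scoped ENNReal NNReal

namespace BlockFading

noncomputable section

/-- The circularly symmetric complex Gaussian law `N_ℂ(0, 1)`: independent real and imaginary
parts, each a centred Gaussian of variance `1/2`. -/
def complexGaussian : Measure ℂ :=
  ((gaussianReal 0 (1 / 2)).prod (gaussianReal 0 (1 / 2))).map fun p : ℝ × ℝ => ⟨p.1, p.2⟩

/-- A family of `L` complex symbols for each of the `B` fading blocks. -/
abbrev Signal (B L : ℕ) : Type := Fin B → Fin L → ℂ

/-- The channel output `y_b = √SNR · h_b · x_b + z_b`, `b = 1, …, B`. -/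
def received {B L : ℕ} (snr : ℝ) (h : Fin B → ℂ) (x z : Signal B L) : Signal B L :=
  fun b l => (Real.sqrt snr : ℂ) * h b * x b l + z b l

/-- The conditional density of the channel output `y` given the channel input `x` and the fading
coefficients `h`. -/
def likelihood {B L : ℕ} (snr : ℝ) (h : Fin B → ℂ) (x y : Signal B L) : ℝ :=
  ∏ b, ∏ l, Real.pi⁻¹ * Real.exp (-‖y b l - (Real.sqrt snr : ℂ) * h b * x b l‖ ^ 2)

/-- Codebooks with `K` codewords, each consisting of `B` blocks of `L` symbols from the
constellation `X`. -/
abbrev Codebook (X : Finset ℂ) (K B L : ℕ) : Type := Fin K → Fin B → Fin L → X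

/-- The complex signal of the `i`-th codeword. -/
def Codebook.word {X : Finset ℂ} {K B L : ℕ} (C : Codebook X K B L) (i : Fin K) : Signal B L :=
  fun b l => (C i b l : ℂ)

/-- Decoders for a given code: they observe the fading coefficients and the channel output. -/
abbrev Decoder (K B L : ℕ) : Type := (Fin B → ℂ) → Signal B L → Fin K

/-- `dec` is a maximum-likelihood decoder for the code `C`. Ties may be broken in any way. -/
def IsMLDecoder {X : Finset ℂ} {K B L : ℕ} (snr : ℝ) (C : Codebook X K B L)
    (dec : Decoder K B L) : Prop :=
  ∀ (h : Fin B → ℂ) (y : Signal B L) (j : Fin K),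
    likelihood snr h (C.word j) y ≤ likelihood snr h (C.word (dec h y)) y

/-- The word error probability of the code `C` with decoder `dec`, for equiprobable messages,
fading coefficients that are i.i.d. over the blocks with law `ν`, and an independent noise vector
with i.i.d. `N_ℂ(0, 1)` entries. -/
def wordErrorProb {X : Finset ℂ} {K B L : ℕ} (ν : Measure ℂ) (snr : ℝ) (C : Codebook X K B L)
    (dec : Decoder K B L) : ℝ≥0∞ :=
  (∑ i : Fin K,
    ((Measure.pi fun _ : Fin B => ν).prod
        (Measure.pi fun _ : Fin B => Measure.pi fun _ : Fin L => complexGaussian))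
      {p : (Fin B → ℂ) × Signal B L | dec p.1 (received snr p.1 (C.word i) p.2) ≠ i}) / (K : ℝ≥0∞)

/-- The word error probability averaged over the random code ensemble in which all symbols of all
codewords are drawn independently and uniformly from the constellation `X`, that is, over a
uniformly distributed codebook. The decoder may depend on the codebook. -/
def avgWordErrorProb {X : Finset ℂ} {K B L : ℕ} (ν : Measure ℂ) (snr : ℝ)
    (dec : Codebook X K B L → Decoder K B L) : ℝ≥0∞ :=
  (∑ C : Codebook X K B L, wordErrorProb ν snr C (dec C)) /
    (Fintype.card (Codebook X K B L) : ℝ≥0∞)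

/-- The number of codewords `2 ^ (B L R)`, rounded up, of a code of rate `R` (in bits per channel
use) and block length `L` over `B` blocks. -/
def numCodewords (B L : ℕ) (R : ℝ) : ℕ := ⌈(2 : ℝ) ^ ((B : ℝ) * L * R)⌉₊

/-- The SNR exponent `liminf_{SNR → ∞} -log P(SNR) / log SNR`, with `-log 0 = ∞`. -/
def snrExponent (P : ℝ → ℝ≥0∞) : EReal :=
  liminf (fun snr : ℝ => -(ENNReal.log (P snr)) / ((Real.log snr : ℝ) : EReal)) atTop

/-- The Singleton bound `d_B(R) = 1 + ⌊B (1 - R / M)⌋`. -/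
def singletonBound (B : ℕ) (M R : ℝ) : ℤ := 1 + ⌊(B : ℝ) * (1 - R / M)⌋

end

end BlockFading

namespace BlockFading

/-! Call a block deeply faded when its power gain is below `SNR^(ε-1)`. The gain density behaves
like `ξ^(m-1)` at the origin, so `k` given blocks are deeply faded with probability
`O(SNR^(-km(1-ε)))`. In any other block the Bhattacharyya factor of two distinct symbols is at most
`exp(-SNR^ε d²/4)`, with `d` the minimum distance of the constellation, while two independent
symbols coincide with probability `2^(-M)`. Each such symbol position thus contributes a factor `g →
2^(-M)`.

The union bound over fewer than `2^(BLR)` competitors, truncated at `1`, gives `min 1 (2^(BLR)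
g^(L(B-k)))` (`avgWordErrorProb_le`). With `L ~ λ log SNR`, `c = λ M log 2` and `u = B(1 - R/M)`,
the case of `k` faded blocks has exponent `km + max 0 (c(u-k))` as `ε → 0`
(`eventually_deepFade_term_le`). The worst integer `k` decides. The floor in the result comes from
`k` being an integer, and the two cases from comparing `c` with `m`. -/

/-! ### Gaussian integrals and the pairwise error bound. -/

theorem lintegral_pi_prod {ι : Type*} [Fintype ι] {α : ι → Type*} [∀ i, MeasurableSpace (α i)]
    (μ : ∀ i, Measure (α i)) [∀ i, IsProbabilityMeasure (μ i)] (f : ∀ i, α i → ℝ≥0∞)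
    (hf : ∀ i, Measurable (f i)) :
    ∫⁻ x, ∏ i, f i (x i) ∂(Measure.pi μ) = ∏ i, ∫⁻ x, f i x ∂(μ i) := by
  have hind : iIndepFun (fun i (x : ∀ i, α i) => f i (x i)) (Measure.pi μ) :=
    iIndepFun_pi fun i => (hf i).aemeasurable
  rw [lintegral_prod_eq_prod_lintegral_of_indepFun Finset.univ _ hind
    fun i => (hf i).comp (measurable_pi_apply i)]
  exact Finset.prod_congr rfl fun i _ => (measurePreserving_eval μ i).lintegral_comp (hf i)

theorem lintegral_exp_mul_gaussianReal (v : ℝ≥0) (t : ℝ) :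
    ∫⁻ x, ENNReal.ofReal (Real.exp (t * x)) ∂(gaussianReal 0 v) =
      ENNReal.ofReal (Real.exp (v * t ^ 2 / 2)) := by
  rw [← ofReal_integral_eq_lintegral_ofReal (integrable_exp_mul_gaussianReal t)
    (ae_of_all _ fun x => (Real.exp_pos _).le)]
  have h := congrFun (mgf_id_gaussianReal (μ := 0) (v := v)) t
  simp only [mgf, id, zero_mul, zero_add] at h
  rw [h]

theorem measurable_complexMk : Measurable fun p : ℝ × ℝ => (⟨p.1, p.2⟩ : ℂ) :=
  Complex.measurableEquivRealProd.symm.measurable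

instance : IsProbabilityMeasure complexGaussian :=
  Measure.isProbabilityMeasure_map measurable_complexMk.aemeasurable

/-- The exponent is affine in `z`, so the integral splits into two real Gaussian moment generating
functions. With variance `1/2` they give `exp(‖δ‖²/4)` against the constant `exp(-‖δ‖²/2)`. The
factor `1/2` is the Chernoff parameter of the Bhattacharyya bound. -/
theorem lintegral_exp_complexGaussian (δ : ℂ) :
    ∫⁻ z, ENNReal.ofReal (Real.exp ((‖z‖ ^ 2 - ‖z + δ‖ ^ 2) / 2)) ∂complexGaussian =
      ENNReal.ofReal (Real.exp (-‖δ‖ ^ 2 / 4)) := by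
  rw [complexGaussian, lintegral_map (by fun_prop) measurable_complexMk]
  have h : ∀ p : ℝ × ℝ, ENNReal.ofReal (Real.exp
      ((‖(⟨p.1, p.2⟩ : ℂ)‖ ^ 2 - ‖(⟨p.1, p.2⟩ : ℂ) + δ‖ ^ 2) / 2)) =
      ENNReal.ofReal (Real.exp (-‖δ‖ ^ 2 / 2)) * (ENNReal.ofReal (Real.exp (-δ.re * p.1)) *
        ENNReal.ofReal (Real.exp (-δ.im * p.2))) := by
    intro p
    rw [← ENNReal.ofReal_mul (Real.exp_pos _).le, ← ENNReal.ofReal_mul (Real.exp_pos _).le,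
      ← Real.exp_add, ← Real.exp_add]
    congr 2
    simp only [← Complex.normSq_eq_norm_sq, Complex.normSq_apply, Complex.add_re, Complex.add_im]
    ring
  simp_rw [h]
  rw [lintegral_const_mul _ (by fun_prop), lintegral_prod_mul
    (f := fun x => ENNReal.ofReal (Real.exp (-δ.re * x)))
    (g := fun x => ENNReal.ofReal (Real.exp (-δ.im * x))) (by fun_prop) (by fun_prop),
    lintegral_exp_mul_gaussianReal, lintegral_exp_mul_gaussianReal,
    ← ENNReal.ofReal_mul (Real.exp_pos _).le, ← ENNReal.ofReal_mul (Real.exp_pos _).le,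
      ← Real.exp_add, ← Real.exp_add]
  congr 2
  simp only [← Complex.normSq_eq_norm_sq, Complex.normSq_apply]
  push_cast
  ring

theorem likelihood_eq_exp {B L : ℕ} (snr : ℝ) (h : Fin B → ℂ) (x y : Signal B L) :
    likelihood snr h x y = (∏ _b : Fin B, ∏ _l : Fin L, Real.pi⁻¹) *
      Real.exp (∑ b, ∑ l, -‖y b l - (Real.sqrt snr : ℂ) * h b * x b l‖ ^ 2) := by
  simp only [likelihood, Finset.prod_mul_distrib, Real.exp_sum]

/-- The law of the noise. -/
noncomputable abbrev noiseMeasure (B L : ℕ) : Measure (Signal B L) :=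
  Measure.pi fun _ : Fin B => Measure.pi fun _ : Fin L => complexGaussian

/-- The Bhattacharyya bound on the pairwise error probability for given fading coefficients. -/
theorem noiseMeasure_likelihood_le {B L : ℕ} {snr : ℝ} (hsnr : 0 ≤ snr) (h : Fin B → ℂ)
    (x x' : Signal B L) :
    noiseMeasure B L {z | likelihood snr h x (received snr h x z) ≤
      likelihood snr h x' (received snr h x z)} ≤
    ∏ b, ∏ l, ENNReal.ofReal (Real.exp (-(snr * ‖h b‖ ^ 2 * ‖x b l - x' b l‖ ^ 2) / 4)) := by
  set δ : Fin B → Fin L → ℂ := fun b l => (Real.sqrt snr : ℂ) * h b * (x b l - x' b l) with hδ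
  let f : Fin B → Fin L → ℂ → ℝ≥0∞ := fun b l z =>
    ENNReal.ofReal (Real.exp ((‖z‖ ^ 2 - ‖z + δ b l‖ ^ 2) / 2))
  have hf : ∀ b l, Measurable (f b l) := fun b l => by fun_prop
  have hint : ∫⁻ z, ∏ b, ∏ l, f b l (z b l) ∂(noiseMeasure B L) =
      ∏ b, ∏ l, ENNReal.ofReal (Real.exp (-(snr * ‖h b‖ ^ 2 * ‖x b l - x' b l‖ ^ 2) / 4)) := by
    rw [lintegral_pi_prod _ (fun b (w : Fin L → ℂ) => ∏ l, f b l (w l))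
      fun b => Finset.measurable_prod _ fun l _ => (hf b l).comp (measurable_pi_apply l)]
    refine Finset.prod_congr rfl fun b _ => ?_
    rw [lintegral_pi_prod _ _ (hf b)]
    refine Finset.prod_congr rfl fun l _ => ?_
    rw [lintegral_exp_complexGaussian]
    have : ‖δ b l‖ ^ 2 = snr * ‖h b‖ ^ 2 * ‖x b l - x' b l‖ ^ 2 := by
      simp only [hδ, norm_mul, mul_pow, Complex.norm_real, Real.norm_eq_abs, sq_abs,
        Real.sq_sqrt hsnr]
    rw [this]
  rw [← hint]
  have hmeas : Measurable fun z : Signal B L => ∏ b, ∏ l, f b l (z b l) :=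
    Finset.measurable_prod _ fun b _ => Finset.measurable_prod _ fun l _ =>
      (hf b l).comp ((measurable_pi_apply l).comp (measurable_pi_apply b))
  have hmarkov := mul_meas_ge_le_lintegral (μ := noiseMeasure B L) hmeas 1
  rw [one_mul] at hmarkov
  refine (measure_mono fun z hz => ?_).trans hmarkov
  simp only [Set.mem_ofPred_eq, likelihood_eq_exp] at hz ⊢
  have hpi : 0 < ∏ _b : Fin B, ∏ _l : Fin L, Real.pi⁻¹ :=
    Finset.prod_pos fun _ _ => Finset.prod_pos fun _ _ => inv_pos.2 Real.pi_pos
  have hz' := Real.exp_le_exp.1 (le_of_mul_le_mul_left hz hpi)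
  have h1 : ∀ b l, received snr h x z b l - (Real.sqrt snr : ℂ) * h b * x b l = z b l :=
    fun b l => by simp only [received]; ring
  have h2 : ∀ b l, received snr h x z b l - (Real.sqrt snr : ℂ) * h b * x' b l =
    z b l + δ b l := fun b l => by simp only [received, hδ]; ring
  simp only [h1, h2] at hz'
  have h3 : ∏ b, ∏ l, f b l (z b l) = ENNReal.ofReal (Real.exp
      (∑ b, ∑ l, (‖z b l‖ ^ 2 - ‖z b l + δ b l‖ ^ 2) / 2)) := by
    simp only [f, Real.exp_sum]
    rw [ENNReal.ofReal_prod_of_nonneg fun _ _ => Finset.prod_nonneg fun _ _ => (Real.exp_pos _).le]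
    refine Finset.prod_congr rfl fun b _ => ?_
    rw [ENNReal.ofReal_prod_of_nonneg fun _ _ => (Real.exp_pos _).le]
  rw [h3, ← ENNReal.ofReal_one]
  refine ENNReal.ofReal_le_ofReal (Real.one_le_exp ?_)
  simp only [← Finset.sum_div, Finset.sum_sub_distrib, Finset.sum_neg_distrib] at hz' ⊢
  linarith

/-! ### Averaging over the random code. -/

/-- Overwriting coordinate `j` loses nothing on the diagonal: the old value is still stored at `i`.
-/
theorem card_filter_apply_eq_mul_card_le {ι α : Type*} [Fintype ι] [DecidableEq ι] [Fintype α]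
    [DecidableEq α] {i j : ι} (hij : i ≠ j) :
    (Finset.univ.filter fun c : ι → α => c i = c j).card * Fintype.card α ≤
      Fintype.card (ι → α) := by
  rw [← Finset.card_univ, ← Finset.card_product, ← Finset.card_univ]
  refine Finset.card_le_card_of_injOn (fun p => Function.update p.1 j p.2) (fun _ _ => by simp) ?_
  rintro ⟨c, x⟩ hc ⟨c', x'⟩ hc' h
  simp only [Finset.coe_product, Set.mem_prod, Finset.mem_coe, Finset.mem_filter,
    Finset.mem_univ, true_and, and_true] at hc hc'
  have hx : x = x' := by simpa using congrFun h j
  have hne : ∀ k, k ≠ j → c k = c' k := fun k hk => by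
    simpa [Function.update_of_ne hk] using congrFun h k
  have hcc : c = c' := by
    funext k
    by_cases hk : k = j
    · rw [hk, ← hc, ← hc', hne i hij]
    · exact hne k hk
  rw [hcc, hx]

/-- Averaging a function of two coordinates of a random tuple that is at most `1` on the diagonal
and at most `e` off the diagonal. -/
theorem sum_apply_apply_le {ι α : Type*} [Fintype ι] [DecidableEq ι] [Fintype α] [DecidableEq α]
    [Nonempty α] {i j : ι} (hij : i ≠ j) (φ : α → α → ℝ≥0∞) (e : ℝ≥0∞) (hd : ∀ x, φ x x ≤ 1)
    (he : ∀ x y, x ≠ y → φ x y ≤ e) :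
    ∑ c : ι → α, φ (c i) (c j) ≤
      Fintype.card (ι → α) * ((Fintype.card α : ℝ≥0∞)⁻¹ + e) := by
  calc ∑ c : ι → α, φ (c i) (c j)
      ≤ ∑ c : ι → α, ((if c i = c j then 1 else 0) + e) := by
        refine Finset.sum_le_sum fun c _ => ?_
        split_ifs with h
        · rw [h]; exact (hd _).trans le_self_add
        · rw [zero_add]; exact he _ _ h
    _ = ((Finset.univ.filter fun c : ι → α => c i = c j).card : ℝ≥0∞) +
          Fintype.card (ι → α) * e := by
        rw [Finset.sum_add_distrib, Finset.sum_boole, Finset.sum_const, nsmul_eq_mul,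
          Finset.card_univ]
    _ ≤ _ := by
        rw [mul_add]
        gcongr
        rw [← div_eq_mul_inv, ENNReal.le_div_iff_mul_le (by simp) (by simp)]
        exact_mod_cast card_filter_apply_eq_mul_card_le hij

/-- Independence across symbol positions: a codebook is a free choice, at each position `(b, l)`, of
a column of `K` symbols. -/
theorem prod_prod_sum_eq_sum_codebook {X : Finset ℂ} {K B L : ℕ}
    (ψ : Fin B → (Fin K → X) → ℝ≥0∞) :
    ∑ C : Codebook X K B L, ∏ b, ∏ l, ψ b (fun k => C k b l) =
      ∏ b, (∑ c : Fin K → X, ψ b c) ^ L := by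
  have h : ∀ b, (∑ c : Fin K → X, ψ b c) ^ L =
      ∑ d : Fin L → Fin K → X, ∏ l, ψ b (d l) := fun b => by
    rw [← Fin.prod_const, Finset.prod_univ_sum, Fintype.piFinset_univ]
  simp_rw [h]
  rw [Finset.prod_univ_sum, Fintype.piFinset_univ]
  let e : Codebook X K B L ≃ (Fin B → Fin L → Fin K → X) :=
    ⟨fun C b l k => C k b l, fun D k b l => D b l k, fun _ => rfl, fun _ => rfl⟩
  exact Fintype.sum_equiv e _ _ fun C => rfl

theorem card_codebook (X : Finset ℂ) (K B L : ℕ) :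
    Fintype.card (Codebook X K B L) = ∏ _b : Fin B, (Fintype.card (Fin K → X)) ^ L := by
  simp only [Fintype.card_pi_const, Finset.prod_const, Finset.card_univ, Fintype.card_fin]
  simp only [← pow_mul]
  congr 1
  ring

/-- The pairwise error bound, averaged over the random code, for given fading coefficients. -/
theorem sum_codebook_prod_exp_le {X : Finset ℂ} [Nonempty X] {K B L : ℕ} {i j : Fin K}
    (hij : i ≠ j) {snr d δ : ℝ} (hsnr : 0 ≤ snr) (hd : ∀ x ∈ X, ∀ y ∈ X, x ≠ y → d ≤ ‖x - y‖)
    (hd0 : 0 ≤ d) (h : Fin B → ℂ) :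
    ∑ C : Codebook X K B L, ∏ b, ∏ l, ENNReal.ofReal
        (Real.exp (-(snr * ‖h b‖ ^ 2 * ‖C.word i b l - C.word j b l‖ ^ 2) / 4)) ≤
      Fintype.card (Codebook X K B L) * ∏ b, (if ‖h b‖ ^ 2 < δ then 1 else
        (X.card : ℝ≥0∞)⁻¹ + ENNReal.ofReal (Real.exp (-(snr * δ * d ^ 2) / 4))) ^ L := by
  let φ : Fin B → X → X → ℝ≥0∞ := fun b x y => ENNReal.ofReal
    (Real.exp (-(snr * ‖h b‖ ^ 2 * ‖(x : ℂ) - y‖ ^ 2) / 4))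
  refine (prod_prod_sum_eq_sum_codebook fun b c => φ b (c i) (c j)).le.trans ?_
  rw [card_codebook]
  push_cast
  rw [← Finset.prod_mul_distrib]
  simp only [← mul_pow]
  gcongr with b
  have h1 : ∀ x y, φ b x y ≤ 1 := fun x y => by
    rw [← ENNReal.ofReal_one]
    refine ENNReal.ofReal_le_ofReal (Real.exp_le_one_iff.2 ?_)
    have : 0 ≤ snr * ‖h b‖ ^ 2 * ‖(x : ℂ) - y‖ ^ 2 := by positivity
    linarith
  split_ifs with hb
  · rw [mul_one]
    refine (Finset.sum_le_card_nsmul _ _ 1 fun c _ => h1 _ _).trans ?_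
    simp
  · rw [← Fintype.card_coe X]
    refine sum_apply_apply_le hij (φ b) _ (fun x => h1 x x) fun x y hxy => ?_
    refine ENNReal.ofReal_le_ofReal (Real.exp_le_exp.2 ?_)
    have h2 := hd x x.2 y y.2 fun h => hxy (Subtype.ext h)
    have h3 : snr * δ * d ^ 2 ≤ snr * ‖h b‖ ^ 2 * ‖(x : ℂ) - y‖ ^ 2 := by
      gcongr
      exact not_lt.1 hb
    linarith

/-! ### Truncated union bound and decomposition by faded blocks. -/

/-- The truncated union bound, with the Bhattacharyya bounds on the pairwise error probabilities,
for the `i`-th message of the code `C` and given fading coefficients. -/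
noncomputable def unionBound {X : Finset ℂ} {K B L : ℕ} (snr : ℝ) (C : Codebook X K B L)
    (i : Fin K) (h : Fin B → ℂ) : ℝ≥0∞ :=
  min 1 (∑ j ∈ Finset.univ.erase i, ∏ b, ∏ l, ENNReal.ofReal
    (Real.exp (-(snr * ‖h b‖ ^ 2 * ‖C.word i b l - C.word j b l‖ ^ 2) / 4)))

theorem measurable_unionBound {X : Finset ℂ} {K B L : ℕ} (snr : ℝ) (C : Codebook X K B L)
    (i : Fin K) : Measurable (unionBound snr C i) := by
  unfold unionBound
  fun_prop

theorem measurable_likelihood_received {B L : ℕ} (snr : ℝ) (x x' : Signal B L) :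
    Measurable fun p : (Fin B → ℂ) × Signal B L =>
      likelihood snr p.1 x' (received snr p.1 x p.2) := by
  unfold likelihood received
  fun_prop

theorem measure_error_le {X : Finset ℂ} {K B L : ℕ} (ν : Measure ℂ) [IsProbabilityMeasure ν]
    {snr : ℝ} (hsnr : 0 ≤ snr) {C : Codebook X K B L} {dec : Decoder K B L}
    (hdec : IsMLDecoder snr C dec) (i : Fin K) :
    ((Measure.pi fun _ : Fin B => ν).prod (noiseMeasure B L))
      {p : (Fin B → ℂ) × Signal B L | dec p.1 (received snr p.1 (C.word i) p.2) ≠ i} ≤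
    ∫⁻ h, unionBound snr C i h ∂(Measure.pi fun _ : Fin B => ν) := by
  let U : Fin K → Set ((Fin B → ℂ) × Signal B L) := fun j =>
    {p | likelihood snr p.1 (C.word i) (received snr p.1 (C.word i) p.2) ≤
      likelihood snr p.1 (C.word j) (received snr p.1 (C.word i) p.2)}
  have hU : MeasurableSet (⋃ j ∈ Finset.univ.erase i, U j) :=
    Finset.measurableSet_biUnion _ fun j _ =>
      measurableSet_le (measurable_likelihood_received _ _ _) (measurable_likelihood_received _ _ _)
  have hsub : {p : (Fin B → ℂ) × Signal B L | dec p.1 (received snr p.1 (C.word i) p.2) ≠ i} ⊆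
      ⋃ j ∈ Finset.univ.erase i, U j := fun p hp => by
    simp only [Set.mem_iUnion]
    exact ⟨_, Finset.mem_erase.2 ⟨hp, Finset.mem_univ _⟩, hdec p.1 _ i⟩
  -- An arbitrary decoder need not have a measurable error event, so the event is enlarged to a
  -- measurable one before slicing over the fading.
  refine (measure_mono hsub).trans ?_
  rw [Measure.prod_apply hU]
  refine lintegral_mono fun h => le_min prob_le_one ?_
  simp only [Set.preimage_iUnion]
  exact (measure_biUnion_finset_le _ _).trans
    (Finset.sum_le_sum fun j _ => noiseMeasure_likelihood_le hsnr h (C.word i) (C.word j))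

/-- The minimum with `1` survives the code average because an average of minima is at most the
minimum of the averages. Truncating at fixed `h` keeps bad fading from being multiplied by the
number of codewords. -/
theorem sum_unionBound_le {X : Finset ℂ} [Nonempty X] {K B L : ℕ}
    {snr d δ : ℝ} (hsnr : 0 ≤ snr) (hd : ∀ x ∈ X, ∀ y ∈ X, x ≠ y → d ≤ ‖x - y‖)
    (hd0 : 0 ≤ d) (h : Fin B → ℂ) {A : ℝ≥0∞} (hA : ((K - 1 : ℕ) : ℝ≥0∞) ≤ A) (i : Fin K) :
    ∑ C : Codebook X K B L, unionBound snr C i h ≤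
      Fintype.card (Codebook X K B L) * min 1 (A * ∏ b, (if ‖h b‖ ^ 2 < δ then 1 else
        (X.card : ℝ≥0∞)⁻¹ + ENNReal.ofReal (Real.exp (-(snr * δ * d ^ 2) / 4))) ^ L) := by
  rw [mul_min_of_nonneg _ _ zero_le]
  refine le_min ?_ ?_
  · refine (Finset.sum_le_card_nsmul _ _ 1 fun C _ => min_le_left _ _).trans ?_
    simp [Finset.card_univ]
  · refine (Finset.sum_le_sum fun C _ => min_le_right _ _).trans ?_
    rw [Finset.sum_comm]
    refine (Finset.sum_le_card_nsmul _ _ _ fun j hj => sum_codebook_prod_exp_le (δ := δ)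
      (Finset.ne_of_mem_erase hj).symm hsnr hd hd0 h).trans ?_
    rw [Finset.card_erase_of_mem (Finset.mem_univ _), Finset.card_univ, Fintype.card_fin,
      nsmul_eq_mul, mul_left_comm]
    gcongr

/-- The term where `S` is exactly the faded set already equals the left side. Asking only that `S`
be faded gives an event with a product probability. -/
theorem min_one_mul_prod_ite_le {B L : ℕ} (p : Fin B → Prop) [DecidablePred p] (A g : ℝ≥0∞) :
    min 1 (A * ∏ b, (if p b then 1 else g) ^ L) ≤
      ∑ S : Finset (Fin B), (if ∀ b ∈ S, p b then 1 else 0) *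
        min 1 (A * g ^ (L * (B - S.card))) := by
  classical
  refine le_trans ?_ (Finset.single_le_sum (fun _ _ => zero_le)
    (Finset.mem_univ (Finset.univ.filter p)))
  rw [if_pos fun b hb => (Finset.mem_filter.1 hb).2, one_mul]
  have : ∏ b, (if p b then 1 else g) ^ L = g ^ (L * (B - (Finset.univ.filter p).card)) := by
    rw [Finset.prod_pow, Finset.prod_ite, Finset.prod_const_one, one_mul, Finset.prod_const,
      ← pow_mul, mul_comm]
    congr 2
    have := Finset.card_filter_add_card_filter_not (s := (Finset.univ : Finset (Fin B))) p
    rw [Finset.card_univ, Fintype.card_fin] at this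
    omega
  rw [this]

theorem pi_forall_mem {B : ℕ} (ν : Measure ℂ) [IsProbabilityMeasure ν] (s : Set ℂ)
    (S : Finset (Fin B)) :
    (Measure.pi fun _ : Fin B => ν) {h | ∀ b ∈ S, h b ∈ s} = ν s ^ S.card := by
  classical
  have : {h : Fin B → ℂ | ∀ b ∈ S, h b ∈ s} =
      Set.pi Set.univ fun b => if b ∈ S then s else Set.univ := by
    ext h
    simp only [Set.mem_ofPred_eq, Set.mem_pi, Set.mem_univ, true_imp_iff]
    refine forall_congr' fun b => ?_
    split_ifs with hb <;> simp [hb]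
  rw [this, Measure.pi_pi]
  simp [apply_ite]

/-- The average word error probability, bounded by a sum over the sets of blocks in deep fade. -/
theorem avgWordErrorProb_le {X : Finset ℂ} [Nonempty X] {K B L : ℕ} (hK : 0 < K)
    (ν : Measure ℂ) [IsProbabilityMeasure ν]
    {snr d δ : ℝ} (hsnr : 0 ≤ snr) (hd : ∀ x ∈ X, ∀ y ∈ X, x ≠ y → d ≤ ‖x - y‖)
    (hd0 : 0 ≤ d) {A : ℝ≥0∞} (hA : ((K - 1 : ℕ) : ℝ≥0∞) ≤ A)
    {dec : Codebook X K B L → Decoder K B L} (hdec : ∀ C, IsMLDecoder snr C (dec C)) :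
    avgWordErrorProb ν snr dec ≤ ∑ S : Finset (Fin B), ν {h | ‖h‖ ^ 2 < δ} ^ S.card *
      min 1 (A * ((X.card : ℝ≥0∞)⁻¹ + ENNReal.ofReal (Real.exp (-(snr * δ * d ^ 2) / 4))) ^
        (L * (B - S.card))) := by
  set g := (X.card : ℝ≥0∞)⁻¹ + ENNReal.ofReal (Real.exp (-(snr * δ * d ^ 2) / 4))
  have hK0 : (K : ℝ≥0∞) ≠ 0 := by simpa using hK.ne'
  have hN0 : (Fintype.card (Codebook X K B L) : ℝ≥0∞) ≠ 0 :=
    have : Nonempty (Codebook X K B L) := inferInstance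
    Nat.cast_ne_zero.2 Fintype.card_ne_zero
  have hmeas : MeasurableSet {h : ℂ | ‖h‖ ^ 2 < δ} :=
    measurableSet_lt (by fun_prop) measurable_const
  have hmeasS : ∀ S : Finset (Fin B),
      MeasurableSet {h : Fin B → ℂ | ∀ b ∈ S, h b ∈ {h : ℂ | ‖h‖ ^ 2 < δ}} := fun S => by
    simp only [Set.ofPred_forall]
    exact Finset.measurableSet_biInter S fun b _ => (measurable_pi_apply b) hmeas
  calc avgWordErrorProb ν snr dec
      ≤ (∑ C : Codebook X K B L, (∑ i, ∫⁻ h, unionBound snr C i h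
          ∂(Measure.pi fun _ : Fin B => ν)) / (K : ℝ≥0∞)) /
          (Fintype.card (Codebook X K B L) : ℝ≥0∞) := by
        unfold avgWordErrorProb wordErrorProb
        gcongr with C _ i _
        exact measure_error_le ν hsnr (hdec C) i
    _ = (∫⁻ h, ∑ i, ∑ C : Codebook X K B L, unionBound snr C i h
          ∂(Measure.pi fun _ : Fin B => ν)) / (K : ℝ≥0∞) /
          (Fintype.card (Codebook X K B L) : ℝ≥0∞) := by
        rw [lintegral_finsetSum _ fun i _ => Finset.measurable_sum _ fun C _ =>
          measurable_unionBound snr C i]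
        simp_rw [lintegral_finsetSum _ fun C _ => measurable_unionBound snr C _]
        simp_rw [div_eq_mul_inv, ← Finset.sum_mul]
        rw [Finset.sum_comm]
    _ ≤ (∫⁻ h, (K : ℝ≥0∞) * (Fintype.card (Codebook X K B L) *
          ∑ S : Finset (Fin B), Set.indicator
            {h : Fin B → ℂ | ∀ b ∈ S, h b ∈ {h : ℂ | ‖h‖ ^ 2 < δ}}
            (fun _ => min 1 (A * g ^ (L * (B - S.card)))) h)
          ∂(Measure.pi fun _ : Fin B => ν)) / (K : ℝ≥0∞) /
          (Fintype.card (Codebook X K B L) : ℝ≥0∞) := by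
        gcongr with h
        refine (Finset.sum_le_card_nsmul _ _ _ fun i _ =>
          (sum_unionBound_le (δ := δ) hsnr hd hd0 h hA i)).trans ?_
        rw [nsmul_eq_mul, Finset.card_univ, Fintype.card_fin]
        gcongr
        refine (min_one_mul_prod_ite_le _ _ _).trans (Finset.sum_le_sum fun S _ => ?_)
        by_cases hS : ∀ b ∈ S, ‖h b‖ ^ 2 < δ
        · have hmem : h ∈ {h : Fin B → ℂ | ∀ b ∈ S, h b ∈ {h : ℂ | ‖h‖ ^ 2 < δ}} := hS
          rw [if_pos hS, one_mul, Set.indicator_of_mem hmem]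
        · rw [if_neg hS, zero_mul]; exact zero_le
    _ = ∫⁻ h, ∑ S : Finset (Fin B), Set.indicator
            {h : Fin B → ℂ | ∀ b ∈ S, h b ∈ {h : ℂ | ‖h‖ ^ 2 < δ}}
            (fun _ => min 1 (A * g ^ (L * (B - S.card)))) h
          ∂(Measure.pi fun _ : Fin B => ν) := by
        have hm : Measurable fun h => ∑ S : Finset (Fin B), Set.indicator
            {h : Fin B → ℂ | ∀ b ∈ S, h b ∈ {h : ℂ | ‖h‖ ^ 2 < δ}}
            (fun _ => min 1 (A * g ^ (L * (B - S.card)))) h :=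
          Finset.measurable_sum _ fun S _ => measurable_const.indicator (hmeasS S)
        rw [lintegral_const_mul _ (hm.const_mul _), lintegral_const_mul _ hm,
          mul_comm (K : ℝ≥0∞), ENNReal.mul_div_cancel_right hK0 (by simp),
          mul_comm, ENNReal.mul_div_cancel_right hN0 (by simp)]
    _ = _ := by
        rw [lintegral_finsetSum _ fun S _ => measurable_const.indicator (hmeasS S)]
        refine Finset.sum_congr rfl fun S _ => ?_
        rw [lintegral_indicator_const (hmeasS S), pi_forall_mem, mul_comm]

/-! ### Probability of a deep fade. -/

theorem measure_norm_sq_lt_le {m : ℝ} (hm : 0 < m) {ν : Measure ℂ}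
    (hν : ν.map (fun h : ℂ => ‖h‖ ^ 2) = gammaMeasure m m) {δ : ℝ} (hδ : 0 < δ) :
    ν {h | ‖h‖ ^ 2 < δ} ≤ ENNReal.ofReal (m ^ m / Real.Gamma m / m * δ ^ m) := by
  set c := m ^ m / Real.Gamma m with hc
  have hc0 : 0 < c := div_pos (Real.rpow_pos_of_pos hm _) (Real.Gamma_pos_of_pos hm)
  -- Discarding `e^(-mx)` leaves a power that may blow up at `0` when `m < 1`, but is integrable
  -- since `m - 1 > -1`.
  have hint : IntegrableOn (fun x : ℝ => c * x ^ (m - 1)) (Set.Ioc 0 δ) := by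
    refine Integrable.const_mul ?_ _
    rw [← IntegrableOn, ← intervalIntegrable_iff_integrableOn_Ioc_of_le hδ.le]
    exact intervalIntegral.intervalIntegrable_rpow' (by linarith)
  have hmap : ν {h | ‖h‖ ^ 2 < δ} = gammaMeasure m m (Set.Iio δ) := by
    rw [← hν, Measure.map_apply (by fun_prop) measurableSet_Iio]
    rfl
  calc ν {h | ‖h‖ ^ 2 < δ} ≤ gammaMeasure m m (Set.Iic δ) :=
        hmap.le.trans (measure_mono Set.Iio_subset_Iic_self)
    _ = ∫⁻ x in Set.Ioc 0 δ, gammaPDF m m x := by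
        rw [gammaMeasure, withDensity_apply _ measurableSet_Iic,
          lintegral_Iic_eq_lintegral_Iio_add_Icc _ hδ.le, lintegral_gammaPDF_of_nonpos le_rfl,
          zero_add, Measure.restrict_congr_set Ioc_ae_eq_Icc]
    _ ≤ ∫⁻ x in Set.Ioc 0 δ, ENNReal.ofReal (c * x ^ (m - 1)) := by
        refine setLIntegral_mono' measurableSet_Ioc fun x hx => ?_
        rw [gammaPDF_of_nonneg hx.1.le]
        refine ENNReal.ofReal_le_ofReal (mul_le_of_le_one_right ?_ ?_)
        · exact mul_nonneg hc0.le (Real.rpow_nonneg hx.1.le _)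
        · exact Real.exp_le_one_iff.2 (neg_nonpos.2 (mul_nonneg hm.le hx.1.le))
    _ = ENNReal.ofReal (c / m * δ ^ m) := by
        rw [← ofReal_integral_eq_lintegral_ofReal hint
          (ae_restrict_of_forall_mem measurableSet_Ioc fun x hx =>
            mul_nonneg hc0.le (Real.rpow_nonneg hx.1.le _)),
          ← intervalIntegral.integral_of_le hδ.le, intervalIntegral.integral_const_mul,
          integral_rpow (Or.inl (by linarith)), sub_add_cancel, Real.zero_rpow hm.ne', sub_zero]
        congr 1
        ring

/-! ### Asymptotics of the error bound. -/

theorem le_snrExponent {T : ℝ} {P : ℝ → ℝ≥0∞} (h : ∀ D < T, ∀ᶠ snr in atTop,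
    P snr ≤ ENNReal.ofReal (Real.exp (-D * Real.log snr))) : (T : EReal) ≤ snrExponent P := by
  refine (le_liminf_iff' (by isBoundedDefault) (by isBoundedDefault)).2 fun y hy => ?_
  obtain ⟨D, hyD, hDT⟩ := EReal.lt_iff_exists_real_btwn.1 hy
  filter_upwards [h D (EReal.coe_lt_coe_iff.1 hDT), eventually_gt_atTop 1] with snr hP hsnr
  refine hyD.le.trans ?_
  rw [EReal.le_div_iff_mul_le (EReal.coe_pos.2 (Real.log_pos hsnr)) (EReal.coe_ne_top _),
    EReal.le_neg, ← EReal.coe_mul, ← EReal.coe_neg, ← neg_mul]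
  refine (ENNReal.log_le_log hP).trans ?_
  rw [ENNReal.log_ofReal_of_pos (Real.exp_pos _), Real.log_exp]

theorem exists_pos_le_norm_sub (X : Finset ℂ) :
    ∃ d : ℝ, 0 < d ∧ ∀ x ∈ X, ∀ y ∈ X, x ≠ y → d ≤ ‖x - y‖ := by
  rcases X.offDiag.eq_empty_or_nonempty with h | h
  · refine ⟨1, one_pos, fun x hx y hy hxy => ?_⟩
    have : (x, y) ∈ X.offDiag := Finset.mem_offDiag.2 ⟨hx, hy, hxy⟩
    simp [h] at this
  · obtain ⟨p, hp, hmin⟩ := X.offDiag.exists_min_image (fun p => ‖p.1 - p.2‖) h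
    refine ⟨_, norm_pos_iff.2 (sub_ne_zero.2 (Finset.mem_offDiag.1 hp).2.2),
      fun x hx y hy hxy => hmin (x, y) (Finset.mem_offDiag.2 ⟨hx, hy, hxy⟩)⟩

theorem numCodewords_pos (B L : ℕ) (R : ℝ) : 0 < numCodewords B L R :=
  Nat.ceil_pos.2 (Real.rpow_pos_of_pos two_pos _)

theorem numCodewords_sub_one_le (B L : ℕ) (R : ℝ) :
    ((numCodewords B L R - 1 : ℕ) : ℝ≥0∞) ≤
      ENNReal.ofReal (Real.exp (L * (B * R * Real.log 2))) := by
  have h1 : Real.exp (L * (B * R * Real.log 2)) = (2 : ℝ) ^ ((B : ℝ) * L * R) := by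
    rw [Real.rpow_def_of_pos two_pos]; congr 1; ring
  rw [h1, ← ENNReal.ofReal_natCast, Nat.cast_sub (numCodewords_pos B L R), Nat.cast_one]
  refine ENNReal.ofReal_le_ofReal ?_
  have := Nat.ceil_lt_add_one (Real.rpow_nonneg two_pos.le ((B : ℝ) * L * R))
  rw [numCodewords]
  linarith

theorem ofReal_exp_pow (a : ℝ) (n : ℕ) :
    ENNReal.ofReal (Real.exp a) ^ n = ENNReal.ofReal (Real.exp (n * a)) := by
  rw [← ENNReal.ofReal_pow (Real.exp_pos _).le, Real.exp_nat_mul]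

theorem ofReal_exp_mul (a b : ℝ) :
    ENNReal.ofReal (Real.exp a) * ENNReal.ofReal (Real.exp b) =
      ENNReal.ofReal (Real.exp (a + b)) := by
  rw [← ENNReal.ofReal_mul (Real.exp_pos _).le, Real.exp_add]

/-- The contribution of `k` blocks in deep fade to the bound on the error probability. -/
theorem eventually_deepFade_term_le {B : ℕ} {M : ℝ} {X : Finset ℂ}
    (hX : (X.card : ℝ) = (2 : ℝ) ^ M) {m : ℝ} (hm : 0 < m) {ν : Measure ℂ}
    (hν : ν.map (fun h : ℂ => ‖h‖ ^ 2) = gammaMeasure m m) {R : ℝ} {L : ℝ → ℕ} {lam : ℝ}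
    (hL : Tendsto (fun snr : ℝ => (L snr : ℝ) / Real.log snr) atTop (𝓝 lam))
    {d : ℝ} (hd : 0 < d) {ε : ℝ} (hε : 0 < ε) {k : ℕ} (hk : k ≤ B) {D : ℝ}
    (hD : D < k * (m * (1 - ε)) + max 0 (lam * ((B - k) * M * Real.log 2 - B * R * Real.log 2))) :
    ∀ᶠ snr in atTop, ν {h | ‖h‖ ^ 2 < Real.exp ((ε - 1) * Real.log snr)} ^ k *
      min 1 (ENNReal.ofReal (Real.exp (L snr * (B * R * Real.log 2))) *
        ((X.card : ℝ≥0∞)⁻¹ + ENNReal.ofReal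
          (Real.exp (-(snr * Real.exp ((ε - 1) * Real.log snr) * d ^ 2) / 4))) ^
            (L snr * (B - k))) ≤ ENNReal.ofReal (Real.exp (-D * Real.log snr)) := by
  have hq : (0 : ℝ) < X.card := hX ▸ Real.rpow_pos_of_pos two_pos _
  set C := m ^ m / Real.Gamma m / m
  have hC0 : 0 < C := div_pos (div_pos (Real.rpow_pos_of_pos hm _) (Real.Gamma_pos_of_pos hm)) hm
  let g : ℝ → ℝ := fun snr =>
    (X.card : ℝ)⁻¹ + Real.exp (-(snr * Real.exp ((ε - 1) * Real.log snr) * d ^ 2) / 4)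
  have hg0 : ∀ snr, 0 < g snr := fun snr => by positivity
  have hexp : ∀ᶠ snr : ℝ in atTop,
      Real.exp (ε * Real.log snr) = snr * Real.exp ((ε - 1) * Real.log snr) := by
    filter_upwards [eventually_gt_atTop 0] with snr hsnr
    rw [sub_mul, one_mul, Real.exp_sub, Real.exp_log hsnr]
    field_simp
  have hg : Tendsto (fun snr => Real.log (g snr)) atTop (𝓝 (-(M * Real.log 2))) := by
    have h1 : Tendsto (fun snr : ℝ => snr * Real.exp ((ε - 1) * Real.log snr)) atTop atTop :=
      (Real.tendsto_exp_atTop.comp (Real.tendsto_log_atTop.const_mul_atTop hε)).congr' hexp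
    have h2 : Tendsto g atTop (𝓝 ((X.card : ℝ)⁻¹ + 0)) := by
      refine tendsto_const_nhds.add (Real.tendsto_exp_atBot.comp ?_)
      refine Tendsto.atBot_div_const (by norm_num) (tendsto_neg_atTop_atBot.comp ?_)
      exact h1.atTop_mul_const (by positivity)
    have h3 := h2.log (by positivity)
    rwa [add_zero, Real.log_inv, hX, Real.log_rpow two_pos] at h3
  -- `ψ` is the logarithm of the explicit bound; `min 0` is the truncation at `1`.
  let ψ : ℝ → ℝ := fun snr => k * (Real.log C + m * ((ε - 1) * Real.log snr)) +
    min 0 (L snr * (B * R * Real.log 2 + (B - k) * Real.log (g snr)))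
  have hψ : Tendsto (fun snr => ψ snr / Real.log snr) atTop (𝓝 (k * (0 + m * (ε - 1)) +
      min 0 (lam * (B * R * Real.log 2 + (B - k) * -(M * Real.log 2))))) := by
    have h1 : Tendsto (fun snr : ℝ => Real.log C / Real.log snr) atTop (𝓝 0) :=
      tendsto_const_nhds.div_atTop Real.tendsto_log_atTop
    have h2 := ((h1.add_const (m * (ε - 1))).const_mul (k : ℝ)).add
      ((tendsto_const_nhds (x := (0 : ℝ))).min
        (hL.mul ((hg.const_mul ((B : ℝ) - k)).const_add (B * R * Real.log 2))))
    refine h2.congr' ?_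
    filter_upwards [eventually_gt_atTop 1] with snr hsnr
    have hlog := Real.log_pos hsnr
    have h3 : ∀ v : ℝ, min 0 ((L snr : ℝ) / Real.log snr * v) =
        min 0 (L snr * v) / Real.log snr := fun v => by
      rw [← min_div_div_right hlog.le, zero_div, div_mul_eq_mul_div]
    rw [h3]
    simp only [ψ]
    field_simp
  have hlim : k * (0 + m * (ε - 1)) +
      min 0 (lam * (B * R * Real.log 2 + (B - k) * -(M * Real.log 2))) < -D := by
    have h1 : lam * (B * R * Real.log 2 + (B - k) * -(M * Real.log 2)) =
      -(lam * ((B - k) * M * Real.log 2 - B * R * Real.log 2)) := by ring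
    have h3 := min_neg_neg (0 : ℝ) (lam * ((B - k) * M * Real.log 2 - B * R * Real.log 2))
    rw [neg_zero] at h3
    rw [h1, h3]
    linarith
  filter_upwards [hψ.eventually_lt_const hlim, eventually_gt_atTop 1] with snr hψD hsnr
  have hlog := Real.log_pos hsnr
  rw [div_lt_iff₀ hlog] at hψD
  have hν' : ν {h | ‖h‖ ^ 2 < Real.exp ((ε - 1) * Real.log snr)} ≤
      ENNReal.ofReal (Real.exp (Real.log C + m * ((ε - 1) * Real.log snr))) := by
    refine (measure_norm_sq_lt_le hm hν (Real.exp_pos _)).trans_eq ?_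
    rw [Real.exp_add, Real.exp_log hC0, ← Real.exp_mul, mul_comm m]
  have hg' : (X.card : ℝ≥0∞)⁻¹ + ENNReal.ofReal
      (Real.exp (-(snr * Real.exp ((ε - 1) * Real.log snr) * d ^ 2) / 4)) =
      ENNReal.ofReal (Real.exp (Real.log (g snr))) := by
    rw [Real.exp_log (hg0 snr), ENNReal.ofReal_add (by positivity) (Real.exp_pos _).le,
      ENNReal.ofReal_inv_of_pos hq, ENNReal.ofReal_natCast]
  calc _ ≤ ENNReal.ofReal (Real.exp (Real.log C + m * ((ε - 1) * Real.log snr))) ^ k *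
        min 1 (ENNReal.ofReal (Real.exp (L snr * (B * R * Real.log 2))) *
          ENNReal.ofReal (Real.exp (Real.log (g snr))) ^ (L snr * (B - k))) := by
        rw [hg']; gcongr
    _ = ENNReal.ofReal (Real.exp (ψ snr)) := by
        have h1 : (1 : ℝ≥0∞) = ENNReal.ofReal (Real.exp 0) := by simp
        rw [ofReal_exp_pow, ofReal_exp_pow, ofReal_exp_mul, h1,
          ← ENNReal.ofReal_min, ← Real.exp_monotone.map_min, ofReal_exp_mul]
        push_cast [hk]
        simp only [ψ]
        congr 4
        ring
    _ ≤ _ := ENNReal.ofReal_le_ofReal (Real.exp_le_exp.2 hψD.le)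

/-- The error exponent is at least any lower bound on the exponents of the contributions of `k`
blocks in deep fade, `k = 0, …, B`. -/
theorem le_snrExponent_avgWordErrorProb {B : ℕ} {M : ℝ} {X : Finset ℂ}
    (hX : (X.card : ℝ) = (2 : ℝ) ^ M) {m : ℝ} (hm : 0 < m) {ν : Measure ℂ} [IsProbabilityMeasure ν]
    (hν : ν.map (fun h : ℂ => ‖h‖ ^ 2) = gammaMeasure m m) {R : ℝ} {L : ℝ → ℕ} {lam : ℝ}
    (hL : Tendsto (fun snr : ℝ => (L snr : ℝ) / Real.log snr) atTop (𝓝 lam))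
    {dec : ∀ snr : ℝ, Codebook X (numCodewords B (L snr) R) B (L snr) →
      Decoder (numCodewords B (L snr) R) B (L snr)}
    (hdec : ∀ snr C, IsMLDecoder snr C (dec snr C)) {T : ℝ}
    (hT : ∀ k : ℕ, k ≤ B →
      T ≤ k * m + max 0 (lam * ((B - k) * M * Real.log 2 - B * R * Real.log 2))) :
    (T : EReal) ≤ snrExponent fun snr => avgWordErrorProb ν snr (dec snr) := by
  have hq : (0 : ℝ) < X.card := hX ▸ Real.rpow_pos_of_pos two_pos _
  have : Nonempty X := (Finset.card_pos.1 (by exact_mod_cast hq)).to_subtype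
  obtain ⟨d, hd0, hd⟩ := exists_pos_le_norm_sub X
  refine le_snrExponent fun D hD => ?_
  obtain ⟨D', hDD', hD'T⟩ := exists_between hD
  -- Raising the fade threshold costs `kmε` in the exponent; this choice keeps it below `T - D'` for
  -- all `k ≤ B`.
  set ε := (T - D') / (m * (B + 1))
  have hε0 : 0 < ε := div_pos (sub_pos.2 hD'T) (by positivity)
  have hεB : ε * (m * (B + 1)) = T - D' := div_mul_cancel₀ _ (by positivity)
  have hterm : ∀ S : Finset (Fin B), _ := fun S =>
    have hS : S.card ≤ B := by simpa using S.card_le_univ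
    eventually_deepFade_term_le (D := D') hX hm hν hL hd0 hε0 hS (by
      have h1 := hT S.card hS
      have h2 : ε * m * S.card < ε * m * (B + 1) := by
        gcongr
        exact_mod_cast Nat.lt_succ_of_le hS
      linarith)
  -- The gap between `D` and `D'` absorbs the number `2^B` of subsets.
  have hcard : Tendsto (fun snr => Real.exp ((D' - D) * Real.log snr)) atTop atTop :=
    Real.tendsto_exp_atTop.comp (Real.tendsto_log_atTop.const_mul_atTop (sub_pos.2 hDD'))
  filter_upwards [eventually_all.2 hterm, hcard.eventually_ge_atTop ((2 : ℝ) ^ B),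
    eventually_ge_atTop 0] with snr hS hB hsnr
  refine (avgWordErrorProb_le (numCodewords_pos _ _ _) ν hsnr hd hd0.le
    (δ := Real.exp ((ε - 1) * Real.log snr))
    (numCodewords_sub_one_le _ _ _) (hdec snr)).trans ?_
  refine (Finset.sum_le_card_nsmul _ _ _ fun S _ => hS S).trans ?_
  rw [Finset.card_univ, Fintype.card_finset, Fintype.card_fin, nsmul_eq_mul,
    ← ENNReal.ofReal_natCast, ← ENNReal.ofReal_mul (Nat.cast_nonneg _)]
  refine ENNReal.ofReal_le_ofReal ?_
  push_cast
  calc (2 : ℝ) ^ B * Real.exp (-D' * Real.log snr)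
      ≤ Real.exp ((D' - D) * Real.log snr) * Real.exp (-D' * Real.log snr) := by gcongr
    _ = Real.exp (-D * Real.log snr) := by rw [← Real.exp_add]; congr 1; ring

/-! ### Minimisation over the number of faded blocks. -/

theorem exponent_le_of_le {m c u : ℝ} (hcm : c ≤ m) (k : ℕ) :
    c * u ≤ k * m + max 0 (c * (u - k)) := by
  have h1 : (k : ℝ) * c ≤ k * m := by gcongr
  have h2 := le_max_right 0 (c * (u - k))
  linarith

/-- As a function of `k`, the right side has slope `m - c ≤ 0` before `u` and `m` after it. The
integer minimum is therefore at `⌊u⌋` or `⌊u⌋ + 1`, which produce the two entries of the `min`. -/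
theorem exponent_le_of_ge {m c u : ℝ} (hm : 0 ≤ m) (hcm : m ≤ c) (k : ℕ) :
    m * ⌊u⌋ + min m (c * (u - ⌊u⌋)) ≤ k * m + max 0 (c * (u - k)) := by
  rcases le_or_gt (k : ℤ) ⌊u⌋ with h | h
  · have h' : (k : ℝ) ≤ ⌊u⌋ := by exact_mod_cast h
    have h1 := min_le_right m (c * (u - ⌊u⌋))
    have h2 := le_max_right 0 (c * (u - k))
    have h3 := mul_nonneg (sub_nonneg.2 hcm) (sub_nonneg.2 h')
    linarith
  · have h' : (⌊u⌋ : ℝ) + 1 ≤ k := by exact_mod_cast h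
    have h1 := min_le_left m (c * (u - ⌊u⌋))
    have h2 := le_max_left 0 (c * (u - k))
    have h3 := mul_le_mul_of_nonneg_left h' hm
    linarith

end BlockFading

theorem mainTheorem3
    (B : ℕ) (hB : 0 < B)
    (M : ℝ) (hM : 0 < M)
    (X : Finset ℂ) (hX : (X.card : ℝ) = (2 : ℝ) ^ M)
    (hpower : (∑ x ∈ X, ‖x‖ ^ 2) / (X.card : ℝ) = 1)
    (m : ℝ) (hm : 0 < m)
    (ν : Measure ℂ) [IsProbabilityMeasure ν]
    (hν : ν.map (fun h : ℂ => ‖h‖ ^ 2) = gammaMeasure m m)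
    (R : ℝ) (hR : 0 ≤ R)
    (L : ℝ → ℕ) (lam : ℝ)
    (hL : Tendsto (fun snr : ℝ => (L snr : ℝ) / Real.log snr) atTop (𝓝 lam))
    (dec : ∀ snr : ℝ,
      BlockFading.Codebook X (BlockFading.numCodewords B (L snr) R) B (L snr) →
        BlockFading.Decoder (BlockFading.numCodewords B (L snr) R) B (L snr))
    (hdec : ∀ snr C, BlockFading.IsMLDecoder snr C (dec snr C)) :
    (lam < m / (M * Real.log 2) →
      ((lam * B * M * Real.log 2 * (1 - R / M) : ℝ) : EReal) ≤
        BlockFading.snrExponent fun snr => BlockFading.avgWordErrorProb ν snr (dec snr)) ∧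
    (m / (M * Real.log 2) ≤ lam →
      ((m * ((BlockFading.singletonBound B M R : ℝ) - 1) +
          min m (lam * M * Real.log 2 *
            ((B : ℝ) * (1 - R / M) - (BlockFading.singletonBound B M R : ℝ) + 1)) : ℝ) : EReal) ≤
        BlockFading.snrExponent fun snr => BlockFading.avgWordErrorProb ν snr (dec snr)) := by
  have hlog2 : 0 < Real.log 2 := Real.log_pos one_lt_two
  have hcoef : ∀ k : ℕ, lam * (((B : ℝ) - k) * M * Real.log 2 - B * R * Real.log 2) =
      lam * (M * Real.log 2) * ((B : ℝ) * (1 - R / M) - k) := fun k => by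
    field_simp
    ring
  refine ⟨fun h => BlockFading.le_snrExponent_avgWordErrorProb hX hm hν hL hdec fun k _ => ?_,
    fun h => BlockFading.le_snrExponent_avgWordErrorProb hX hm hν hL hdec fun k _ => ?_⟩
  · rw [lt_div_iff₀ (by positivity)] at h
    rw [hcoef]
    refine le_trans (le_of_eq ?_) (BlockFading.exponent_le_of_le h.le k)
    ring
  · rw [div_le_iff₀ (by positivity)] at h
    rw [hcoef]
    refine le_trans (le_of_eq ?_) (BlockFading.exponent_le_of_ge hm.le h k)
    simp only [BlockFading.singletonBound]
    push_cast
    congr 1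
    · ring
    · congr 1
      ring
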